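/- Let $\mathbb{R}_+=(0,\infty)$ and $\Delta g(x)=g(x+1)-g(x)$. For $p,k\in\mathbb{N}=\{0,1,2,\dots\}$ let $\mathcal{C}^k$ be the set of $k$ times continuously differentiable functions $\mathbb{R}_+\to\mathbb{R}$; let $\mathcal{D}^p$ be the set of functions $g\colon\mathbb{R}_+\to\mathbb{R}$ with $\Delta^p g(x)\to 0$ as $x\to\infty$; and let $\mathcal{K}^p$ be the set of functions $f\colon\mathbb{R}_+\to\mathbb{R}$ that are eventually $p$-convex or eventually $p$-concave, i.e. for which there is $a>0$ such that either the divided differences $f[x_0,\dots,x_{p+1}]$ are $\ge 0$ for all $a<x_0<\dots<x_{p+1}$, or they are $\le 0$ for all such points. For $g\in\bigcup_{p\ge 0}(\mathcal{D}^p\cap\mathcal{K}^p)$ define $\Sigma g\colon\mathbb{R}_+\to\mathbb{R}$ by $\Sigma g(x)=\lim_{n\to\infty}f^p_n[g](x)$, where $p$ is such that $g\in\mathcal{D}^p\cap\mathcal{K}^p$ and $$f^p_n[g](x)=-g(x)+\sum_{k=1}^{n-1}\bigl(g(k)-g(x+k)\bigr)+\sum_{j=1}^{p}\binom{x}{j}\Delta^{j-1}g(n).$$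 **Proposition 7.3.** For every $p\in\mathbb{N}$ there exists $g\in\mathcal{C}^{p+1}\cap\mathcal{D}^p\cap\mathcal{K}^p$ such that $\Sigma g\notin\mathcal{C}^{p+1}$, where the limit defining $\Sigma g$ exists on $\mathbb{R}_+$ and is the same for every $q\in\mathbb{N}$ with $g\in\mathcal{D}^q\cap\mathcal{K}^q$ used in place of $p$. (So $\Sigma$ does not always preserve differentiability when the order of differentiability exceeds the order of convexity.) More precisely, $g$ can be chosen so that, in addition, $\Sigma g\in\mathcal{C}^{p}$ and $(\Sigma g)^{(p)}$ is not differentiable at any positive integer; for $p=0$ this says that $\Sigma g$ is continuous and not differentiable at any positive integer. -/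

import Mathlib

open Filter Topology Set

/-!
Functions on the open half-line `(0, ∞)` are represented by functions `ℝ → ℝ`; every notion below
depends only on the values at positive arguments.
-/

namespace PrincipalSum

/-- The divided difference `f[x₀, …, xₙ]` at pairwise distinct points. -/
noncomputable def divDiff {n : ℕ} (f : ℝ → ℝ) (x : Fin (n + 1) → ℝ) : ℝ :=
  ∑ k, f (x k) / ∏ j ∈ Finset.univ.erase k, (x k - x j)

/-- `f` is `p`-convex on `I`: `f[x₀, …, x_{p+1}] ≥ 0` for all `x₀ < ⋯ < x_{p+1}` in `I`. -/
def PConvexOn (p : ℕ) (I : Set ℝ) (f : ℝ → ℝ) : Prop :=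
  ∀ x : Fin (p + 2) → ℝ, StrictMono x → (∀ i, x i ∈ I) → 0 ≤ divDiff f x

/-- `f` is `p`-concave on `I`: `f[x₀, …, x_{p+1}] ≤ 0` for all `x₀ < ⋯ < x_{p+1}` in `I`. -/
def PConcaveOn (p : ℕ) (I : Set ℝ) (f : ℝ → ℝ) : Prop :=
  ∀ x : Fin (p + 2) → ℝ, StrictMono x → (∀ i, x i ∈ I) → divDiff f x ≤ 0

/-- `𝒞ᵏ`: the functions that are `k` times continuously differentiable on `(0, ∞)`. -/
def ClassC (k : ℕ) : Set (ℝ → ℝ) :=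
  {f | ContDiffOn ℝ k f (Ioi 0)}

/-- `𝒟ᵖ`: the functions `g` with `Δᵖ g(x) → 0` as `x → ∞`, where `Δ g(x) = g(x + 1) - g(x)`. -/
def ClassD (p : ℕ) : Set (ℝ → ℝ) :=
  {g | Tendsto ((fwdDiff (1 : ℝ))^[p] g) atTop (𝓝 0)}

/-- `𝒦ᵖ`: the functions that are eventually `p`-convex or eventually `p`-concave. -/
def ClassK (p : ℕ) : Set (ℝ → ℝ) :=
  {f | (∃ a : ℝ, 0 < a ∧ PConvexOn p (Ioi a) f) ∨ (∃ a : ℝ, 0 < a ∧ PConcaveOn p (Ioi a) f)}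

/-- `fₙᵖ[g](x) = -g(x) + ∑_{k=1}^{n-1} (g(k) - g(x+k)) + ∑_{j=1}^{p} C(x,j) Δ^{j-1}g(n)`
(relevant for `n ≥ 1`). -/
noncomputable def approxSum (p n : ℕ) (g : ℝ → ℝ) (x : ℝ) : ℝ :=
  -g x + ∑ k ∈ Finset.Ico 1 n, (g k - g (x + k))
    + ∑ j ∈ Finset.Icc 1 p, Ring.choose x j * (fwdDiff (1 : ℝ))^[j - 1] g n

/-- The map `Σ`: for `g` in the domain `⋃ p, 𝒟ᵖ ∩ 𝒦ᵖ`, `Σ g` is the pointwise limit of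
`fₙᵖ[g]` as `n → ∞`, where `p` is such that `g ∈ 𝒟ᵖ ∩ 𝒦ᵖ` (the least such `p` is taken; the
limit is the same for all of them). Outside the domain the value is meaningless. -/
noncomputable def sigmaMap (g : ℝ → ℝ) (x : ℝ) : ℝ :=
  limUnder atTop fun n : ℕ => approxSum (sInf {p : ℕ | g ∈ ClassD p ∩ ClassK p}) n g x

end PrincipalSum

/-!
The counterexample is a function all of whose derivatives up to order `p` decay exponentially, so
that `Σ g` is, up to an additive constant, the negative of the sum of the translates `g(x + j)`,
`j ≥ 0`.

Let `G` be a decreasing `C¹` staircase (`staircase`) with a step at each natural number `k`, of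
height `exp (-2k)` and so steep that its slope at `k` is `-1/4`. The heights decrease fast enough
that `0 ≤ G(x) ≤ C exp (-x)` although `G'(m) ≤ -1/4` at every natural number `m`. Then
`S(x) = ∑_{j ≥ 0} G(x + j)` is continuous, but not differentiable at any `m`: for each `N`, it is
the sum of `N` translates with slope at most `-1/4` at `m` and of a decreasing function
(`not_differentiableAt_shiftSum`), so its derivative at `m` would be at most `-N/4` for all `N`.
This is the example for `p = 0`.

For general `p`, let `g` be the `p`-fold iterated tail integral of `G`. Tail integration preserves
nonnegativity and the bound by a multiple of `exp (-x)`, it inverts differentiation up to sign, and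
it raises smoothness by one. Hence `g` is of class `C^{p+1}`, tends to zero with all its
differences, and `g⁽ᵖ⁺¹⁾` has constant sign, which gives `p`-convexity or `p`-concavity through the
mean value theorem for divided differences (`exists_divDiff_eq_iteratedDeriv`). All the correction
terms in `approxSum q` vanish in the limit (`NonnegExpDecay.tendsto_approxSum`), so the limit is the
same for every `q`, and termwise differentiation (`hasDerivAt_shiftSum`) shows that the `p`-th
derivative of the sum of the translates of `g` is `(-1)ᵖ S`.
-/

namespace PrincipalSum

/-! ### Divided differences and derivatives -/

/-- Iterated Rolle theorem: `n + 1` zeros of `f` force a zero of its `n`-th derivative. -/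
theorem exists_iteratedDeriv_eq_zero {n : ℕ} {f : ℝ → ℝ} (hf : ContDiff ℝ n f)
    {x : Fin (n + 1) → ℝ} (hx : StrictMono x) (h0 : ∀ i, f (x i) = 0) :
    ∃ ξ, iteratedDeriv n f ξ = 0 := by
  induction n generalizing f with
  | zero => exact ⟨x 0, by simpa using h0 0⟩
  | succ n ih =>
    have hrolle : ∀ i : Fin (n + 1), ∃ c ∈ Ioo (x i.castSucc) (x i.succ), deriv f c = 0 := fun i =>
      exists_deriv_eq_zero (hx i.castSucc_lt_succ) hf.continuous.continuousOn (by rw [h0, h0])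
    choose y hy hy0 using hrolle
    have hmono : StrictMono y := by
      intro i j hij
      calc y i < x i.succ := (hy i).2
        _ ≤ x j.castSucc := hx.monotone (by simpa [Fin.le_def] using hij)
        _ < y j := (hy j).1
    have hf' : ContDiff ℝ n (deriv f) := by
      have h : ContDiff ℝ (n + 1) f := by exact_mod_cast hf
      exact (contDiff_succ_iff_deriv.mp h).2.2
    obtain ⟨ξ, hξ⟩ := ih hf' hmono hy0
    exact ⟨ξ, by rw [iteratedDeriv_succ', hξ]⟩

theorem iteratedDeriv_polynomial_eval (P : Polynomial ℝ) (n : ℕ) :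
    iteratedDeriv n (fun x => P.eval x) = fun x => (Polynomial.derivative^[n] P).eval x := by
  induction n generalizing P with
  | zero => simp
  | succ n ih =>
    rw [iteratedDeriv_succ', Function.iterate_succ_apply, ← ih]
    congr 1
    ext x
    simp

/-- Mean value theorem for divided differences: `f[x₀, …, xₙ] = f⁽ⁿ⁾(ξ) / n!` for some `ξ`. -/
theorem exists_divDiff_eq_iteratedDeriv {n : ℕ} {f : ℝ → ℝ} (hf : ContDiff ℝ n f)
    {x : Fin (n + 1) → ℝ} (hx : StrictMono x) :
    ∃ ξ, divDiff f x = iteratedDeriv n f ξ / n.factorial := by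
  have hinj : Set.InjOn x (Finset.univ : Finset (Fin (n + 1))) := hx.injective.injOn
  -- the polynomial of degree at most `n` that interpolates `f` at the nodes
  set P : Polynomial ℝ := Lagrange.interpolate Finset.univ x fun i => f (x i)
  have hPeval : ∀ i, P.eval (x i) = f (x i) := fun i =>
    Lagrange.eval_interpolate_at_node _ hinj (Finset.mem_univ i)
  have hPdeg : P.degree < (Finset.univ : Finset (Fin (n + 1))).card :=
    Lagrange.degree_interpolate_lt _ hinj
  have hPcont : ContDiff ℝ n fun t => P.eval t := by
    simpa using P.contDiff_aeval (𝕜 := ℝ) n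
  obtain ⟨ξ, hξ⟩ := exists_iteratedDeriv_eq_zero (hf.sub hPcont) hx fun i => by simp [hPeval]
  rw [iteratedDeriv_fun_sub hf.contDiffAt hPcont.contDiffAt,
    iteratedDeriv_polynomial_eval, sub_eq_zero] at hξ
  refine ⟨ξ, ?_⟩
  have hcoeff : (Polynomial.derivative^[n] P).eval ξ = n.factorial * divDiff f x := by
    rw [Lagrange.eval_iterate_derivative_eq_sum hinj hPdeg (by simp)]
    simp [divDiff, hPeval]
  simp only [hξ, hcoeff]
  field_simp

/-! ### Tail integrals of exponentially decaying functions -/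

/-- `F` is nonnegative and bounded above by a multiple of `exp (-x)` on the whole real line. -/
def NonnegExpDecay (F : ℝ → ℝ) : Prop :=
  ∃ C, ∀ x, 0 ≤ F x ∧ F x ≤ C * Real.exp (-x)

/-- The tail integral `x ↦ ∫ₓ^∞ F`. -/
noncomputable def tailIntegral (F : ℝ → ℝ) (x : ℝ) : ℝ :=
  ∫ t in Ioi x, F t

theorem NonnegExpDecay.integrableOn_Ioi {F : ℝ → ℝ} (h : NonnegExpDecay F) (hc : Continuous F)
    (x : ℝ) : MeasureTheory.IntegrableOn F (Ioi x) := by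
  obtain ⟨C, hC⟩ := h
  have hexp : MeasureTheory.IntegrableOn (fun t => C * Real.exp (-t)) (Ioi x) :=
    (integrableOn_exp_neg_Ioi x).const_mul C
  refine hexp.mono' hc.aestronglyMeasurable (Eventually.of_forall fun t => ?_)
  rw [Real.norm_of_nonneg (hC t).1]
  exact (hC t).2

theorem NonnegExpDecay.tailIntegral {F : ℝ → ℝ} (h : NonnegExpDecay F) (hc : Continuous F) :
    NonnegExpDecay (tailIntegral F) := by
  have hint := h.integrableOn_Ioi hc
  obtain ⟨C, hC⟩ := h
  refine ⟨C, fun x =>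
    ⟨MeasureTheory.integral_nonneg fun t => (hC t).1, ?_⟩⟩
  have hexp : MeasureTheory.IntegrableOn (fun t => C * Real.exp (-t)) (Ioi x) :=
    (integrableOn_exp_neg_Ioi x).const_mul C
  calc ∫ t in Ioi x, F t ≤ ∫ t in Ioi x, C * Real.exp (-t) :=
        MeasureTheory.integral_mono (hint x) hexp fun t => (hC t).2
    _ = C * Real.exp (-x) := by
        rw [MeasureTheory.integral_const_mul, integral_exp_neg_Ioi]

theorem hasDerivAt_tailIntegral {F : ℝ → ℝ} (h : NonnegExpDecay F) (hc : Continuous F) (x : ℝ) :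
    HasDerivAt (tailIntegral F) (-F x) x := by
  have heq : tailIntegral F = fun y => tailIntegral F 0 - ∫ t in (0 : ℝ)..y, F t := by
    ext y
    have := intervalIntegral.integral_Ioi_sub_Ioi' (h.integrableOn_Ioi hc 0)
      (h.integrableOn_Ioi hc y)
    simp only [tailIntegral]
    linarith
  rw [heq]
  exact (hc.integral_hasStrictDerivAt 0 x).hasDerivAt.const_sub _

theorem nonnegExpDecay_and_continuous_iterate_tailIntegral {F : ℝ → ℝ}
    (h : NonnegExpDecay F) (hc : Continuous F) (i : ℕ) :
    NonnegExpDecay (tailIntegral^[i] F) ∧ Continuous (tailIntegral^[i] F) := by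
  induction i with
  | zero => exact ⟨h, hc⟩
  | succ i ih =>
    rw [Function.iterate_succ_apply']
    exact ⟨ih.1.tailIntegral ih.2, continuous_iff_continuousAt.2 fun x =>
      (hasDerivAt_tailIntegral ih.1 ih.2 x).continuousAt⟩

theorem hasDerivAt_iterate_tailIntegral {F : ℝ → ℝ} (h : NonnegExpDecay F) (hc : Continuous F)
    (i : ℕ) (x : ℝ) :
    HasDerivAt (tailIntegral^[i + 1] F) (-(tailIntegral^[i] F) x) x := by
  rw [Function.iterate_succ_apply']
  exact hasDerivAt_tailIntegral (nonnegExpDecay_and_continuous_iterate_tailIntegral h hc i).1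
    (nonnegExpDecay_and_continuous_iterate_tailIntegral h hc i).2 x

/-- In a chain of functions in which each one is the negative of the derivative of the next one,
the `i`-th derivative of the `i`-th function is `(-1)ⁱ` times the initial one; smoothness of the
initial function is raised by `i`. -/
theorem contDiff_and_iteratedDeriv_of_chain {u : ℕ → ℝ → ℝ}
    (hu : ∀ i x, HasDerivAt (u (i + 1)) (-u i x) x) {k : ℕ} (h0 : ContDiff ℝ k (u 0)) (i : ℕ) :
    ContDiff ℝ (i + k : ℕ) (u i) ∧ iteratedDeriv i (u i) = fun x => (-1) ^ i * u 0 x := by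
  induction i with
  | zero => simpa using h0
  | succ i ih =>
    have hderiv : deriv (u (i + 1)) = -u i := funext fun x => (hu i x).deriv
    constructor
    · have : ((i + 1 + k : ℕ) : WithTop ℕ∞) = (i + k : ℕ) + 1 := by
        push_cast
        ring
      rw [this, contDiff_succ_iff_deriv, hderiv]
      exact ⟨fun x => (hu i x).differentiableAt, by simp, ih.1.neg⟩
    · rw [iteratedDeriv_succ', hderiv]
      ext x
      rw [iteratedDeriv_neg, ih.2]
      ring

/-! ### Sums over integer translates -/

/-- The sum `x ↦ ∑_{j ≥ 0} F(x + j)` of the translates of `F`. -/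
noncomputable def shiftSum (F : ℝ → ℝ) (x : ℝ) : ℝ :=
  ∑' j : ℕ, F (x + j)

theorem NonnegExpDecay.exists_summable_bound {F : ℝ → ℝ} (h : NonnegExpDecay F) (a : ℝ) :
    ∃ u : ℕ → ℝ, Summable u ∧ ∀ (j : ℕ) (x : ℝ), x ∈ Ioi a → ‖F (x + j)‖ ≤ u j := by
  obtain ⟨C, hC⟩ := h
  have hC0 : 0 ≤ C := by
    have := (hC 0).1.trans (hC 0).2
    simpa using this
  refine ⟨fun j => C * Real.exp (-a) * Real.exp (-j), Real.summable_exp_neg_nat.mul_left _,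
    fun j x hx => ?_⟩
  beta_reduce
  rw [Real.norm_of_nonneg (hC _).1, mul_assoc, ← Real.exp_add]
  refine (hC _).2.trans (mul_le_mul_of_nonneg_left (Real.exp_le_exp.2 ?_) hC0)
  have : a < x := hx
  linarith

theorem NonnegExpDecay.summable {F : ℝ → ℝ} (h : NonnegExpDecay F) (x : ℝ) :
    Summable fun j : ℕ => F (x + j) := by
  obtain ⟨u, hu, hF⟩ := h.exists_summable_bound (x - 1)
  exact hu.of_norm_bounded fun j => hF j x (by simp)

theorem NonnegExpDecay.continuous_shiftSum {F : ℝ → ℝ} (h : NonnegExpDecay F)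
    (hc : Continuous F) : Continuous (shiftSum F) := by
  refine continuous_iff_continuousAt.2 fun x => ?_
  obtain ⟨u, hu, hF⟩ := h.exists_summable_bound (x - 1)
  exact (continuousOn_tsum (fun j => (hc.comp (continuous_add_const _)).continuousOn) hu
    hF).continuousAt (Ioi_mem_nhds (by linarith))

theorem hasDerivAt_shiftSum {F G : ℝ → ℝ} (hF : NonnegExpDecay F) (hG : NonnegExpDecay G)
    (hd : ∀ x, HasDerivAt G (-F x) x) (x : ℝ) :
    HasDerivAt (shiftSum G) (-shiftSum F x) x := by
  obtain ⟨u, hu, hbound⟩ := hF.exists_summable_bound (x - 1)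
  have hx : x ∈ Ioi (x - 1) := by simp
  have := hasDerivAt_tsum_of_isPreconnected (g := fun (j : ℕ) y => G (y + j))
    (g' := fun (j : ℕ) y => -F (y + j)) hu isOpen_Ioi isPreconnected_Ioi
    (fun j y _ => (hd (y + j)).comp_add_const y j) (fun j y hy => by simpa using hbound j y hy)
    hx (hG.summable x) hx
  rwa [tsum_neg] at this

/-- If `F` decreases and the derivatives of `F` at the points `x + j` are bounded above by a
negative constant, then the sum of the translates is not differentiable at `x`: each translate
contributes a fixed negative amount to the derivative, and the remainder is decreasing. -/
theorem not_differentiableAt_shiftSum {F : ℝ → ℝ} (h : NonnegExpDecay F) (hanti : Antitone F)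
    {F' : ℝ → ℝ} {x c : ℝ} (hc : 0 < c) (hd : ∀ j : ℕ, HasDerivAt F (F' (x + j)) (x + j))
    (hF' : ∀ j : ℕ, F' (x + j) ≤ -c) :
    ¬ DifferentiableAt ℝ (shiftSum F) x := by
  intro hdiff
  have hbound : ∀ N : ℕ, deriv (shiftSum F) x ≤ N * -c := by
    intro N
    have hsplit : (fun y => shiftSum F (y + N)) =
        fun y => shiftSum F y - ∑ j ∈ Finset.range N, F (y + j) := by
      ext y
      have := (h.summable y).sum_add_tsum_nat_add N
      simp only [shiftSum, add_assoc]
      rw [← this]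
      simp [add_comm]
    have hrest : Antitone fun y => shiftSum F (y + N) := fun y z hyz =>
      (h.summable _).tsum_le_tsum (fun j => hanti (by gcongr)) (h.summable _)
    have hder : HasDerivAt (fun y => shiftSum F (y + N))
        (deriv (shiftSum F) x - ∑ j ∈ Finset.range N, F' (x + j)) x := by
      rw [hsplit]
      exact hdiff.hasDerivAt.sub
        (HasDerivAt.fun_sum fun j _ => (hd j).comp_add_const x j)
    have h1 := hrest.deriv_nonpos (x := x)
    rw [hder.deriv] at h1
    have h2 : ∑ j ∈ Finset.range N, F' (x + j) ≤ N * -c := by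
      simpa using Finset.sum_le_card_nsmul (Finset.range N) (fun j : ℕ => F' (x + j)) (-c)
        fun j _ => hF' j
    linarith
  obtain ⟨N, hN⟩ := exists_nat_gt (-deriv (shiftSum F) x / c)
  rw [div_lt_iff₀ hc] at hN
  linarith [hbound N]

/-! ### A smooth staircase with steep steps at the integers -/

/-- A smooth decreasing step at `k`: of height `exp (-2k)`, and with slope `-1/4` at `k`. -/
noncomputable def smoothStep (k : ℕ) (x : ℝ) : ℝ :=
  Real.exp (-(2 * k)) * Real.sigmoid ((k - x) * Real.exp (2 * k))

/-- The negative of the derivative of `smoothStep k`. -/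
noncomputable def smoothStepSlope (k : ℕ) (x : ℝ) : ℝ :=
  Real.sigmoid ((k - x) * Real.exp (2 * k)) * Real.sigmoid (-((k - x) * Real.exp (2 * k)))

/-- The sum of the steps `smoothStep k` for all natural numbers `k`. -/
noncomputable def staircase (x : ℝ) : ℝ :=
  ∑' k : ℕ, smoothStep k x

/-- The negative of the derivative of `staircase`. -/
noncomputable def staircaseSlope (x : ℝ) : ℝ :=
  ∑' k : ℕ, smoothStepSlope k x

/-- An exponential bound that does not depend on the steepness `a`. -/
theorem sigmoid_mul_le_exp {a : ℝ} (ha : 1 ≤ a) (y : ℝ) : Real.sigmoid (y * a) ≤ Real.exp y := by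
  rcases le_total 0 y with hy | hy
  · exact (Real.sigmoid_le_one _).trans (Real.one_le_exp hy)
  · -- `sigmoid z = sigmoid (-z) * exp z ≤ exp z`
    have h1 : Real.sigmoid (y * a) ≤ Real.exp (y * a) := by
      have h2 := Real.sigmoid_mul_rexp_neg (-(y * a))
      rw [neg_neg] at h2
      rw [← h2]
      exact mul_le_of_le_one_left (Real.exp_pos _).le (Real.sigmoid_le_one _)
    exact h1.trans (Real.exp_le_exp.2 (by nlinarith))

theorem one_le_exp_two_mul (k : ℕ) : 1 ≤ Real.exp (2 * k) := Real.one_le_exp (by positivity)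

theorem smoothStep_nonneg (k : ℕ) (x : ℝ) : 0 ≤ smoothStep k x :=
  mul_nonneg (Real.exp_pos _).le (Real.sigmoid_nonneg _)

theorem smoothStep_le (k : ℕ) (x : ℝ) : smoothStep k x ≤ Real.exp (-k) * Real.exp (-x) := by
  calc smoothStep k x ≤ Real.exp (-(2 * k)) * Real.exp (k - x) :=
        mul_le_mul_of_nonneg_left (sigmoid_mul_le_exp (one_le_exp_two_mul k) _)
          (Real.exp_pos _).le
    _ = Real.exp (-k) * Real.exp (-x) := by
        rw [← Real.exp_add, ← Real.exp_add]
        ring_nf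

theorem smoothStepSlope_nonneg (k : ℕ) (x : ℝ) : 0 ≤ smoothStepSlope k x :=
  mul_nonneg (Real.sigmoid_nonneg _) (Real.sigmoid_nonneg _)

/-- The slopes of the steps at `k` are summable in `k`, locally uniformly in `x`, since they decay
fast to the left of `k`. -/
theorem smoothStepSlope_le (k : ℕ) (x : ℝ) :
    smoothStepSlope k x ≤ Real.exp x * Real.exp (-k) := by
  calc smoothStepSlope k x ≤ Real.sigmoid ((x - k) * Real.exp (2 * k)) := by
        rw [smoothStepSlope, ← neg_mul, neg_sub]
        exact mul_le_of_le_one_left (Real.sigmoid_nonneg _) (Real.sigmoid_le_one _)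
    _ ≤ Real.exp (x - k) := sigmoid_mul_le_exp (one_le_exp_two_mul k) _
    _ = Real.exp x * Real.exp (-k) := by rw [← Real.exp_add, sub_eq_add_neg]

theorem hasDerivAt_smoothStep (k : ℕ) (x : ℝ) :
    HasDerivAt (smoothStep k) (-smoothStepSlope k x) x := by
  have hlin : HasDerivAt (fun y : ℝ => (k - y) * Real.exp (2 * k)) (-1 * Real.exp (2 * k)) x :=
    ((hasDerivAt_id x).const_sub _).mul_const _
  have := ((Real.hasDerivAt_sigmoid _).comp x hlin).const_mul (Real.exp (-(2 * k)))
  convert! this using 1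
  have hexp : Real.exp (-(2 * k)) * Real.exp (2 * k) = 1 := by
    rw [← Real.exp_add, neg_add_cancel, Real.exp_zero]
  rw [smoothStepSlope, Real.sigmoid_neg]
  linear_combination (Real.sigmoid ((k - x) * Real.exp (2 * k)) *
    (1 - Real.sigmoid ((k - x) * Real.exp (2 * k)))) * hexp

theorem continuous_smoothStepSlope (k : ℕ) : Continuous (smoothStepSlope k) := by
  have hlin : Continuous fun x : ℝ => (k - x) * Real.exp (2 * k) := by fun_prop
  exact (continuous_sigmoid.comp hlin).mul (continuous_sigmoid.comp hlin.neg)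

theorem smoothStepSlope_self (k : ℕ) : smoothStepSlope k k = 1 / 4 := by
  simp only [smoothStepSlope, sub_self, zero_mul, neg_zero, Real.sigmoid_zero]
  norm_num

theorem summable_smoothStep (x : ℝ) : Summable fun k => smoothStep k x :=
  Summable.of_nonneg_of_le (fun k => smoothStep_nonneg k x) (fun k => smoothStep_le k x)
    (Real.summable_exp_neg_nat.mul_right _)

theorem summable_smoothStepSlope (x : ℝ) : Summable fun k => smoothStepSlope k x :=
  Summable.of_nonneg_of_le (fun k => smoothStepSlope_nonneg k x) (fun k => smoothStepSlope_le k x)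
    (Real.summable_exp_neg_nat.mul_left _)

theorem nonnegExpDecay_staircase : NonnegExpDecay staircase := by
  refine ⟨∑' k : ℕ, Real.exp (-k), fun x => ⟨tsum_nonneg fun k => smoothStep_nonneg k x, ?_⟩⟩
  rw [← tsum_mul_right]
  exact (summable_smoothStep x).tsum_le_tsum (fun k => smoothStep_le k x)
    (Real.summable_exp_neg_nat.mul_right _)

theorem norm_smoothStepSlope_le {a y : ℝ} (hy : y ∈ Iio a) (k : ℕ) :
    ‖smoothStepSlope k y‖ ≤ Real.exp a * Real.exp (-k) := by
  rw [Real.norm_of_nonneg (smoothStepSlope_nonneg k y)]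
  refine (smoothStepSlope_le k y).trans ?_
  gcongr
  exact le_of_lt hy

theorem hasDerivAt_staircase (x : ℝ) : HasDerivAt staircase (-staircaseSlope x) x := by
  have hx : x ∈ Iio (x + 1) := by simp
  have := hasDerivAt_tsum_of_isPreconnected (g := smoothStep)
    (g' := fun k y => -smoothStepSlope k y)
    (Real.summable_exp_neg_nat.mul_left (Real.exp (x + 1))) isOpen_Iio isPreconnected_Iio
    (fun k y _ => hasDerivAt_smoothStep k y)
    (fun k y hy => by simpa using norm_smoothStepSlope_le hy k) hx (summable_smoothStep x) hx
  rwa [tsum_neg] at this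

theorem continuous_staircaseSlope : Continuous staircaseSlope := by
  refine continuous_iff_continuousAt.2 fun x => ?_
  exact (continuousOn_tsum (fun k => (continuous_smoothStepSlope k).continuousOn)
    (Real.summable_exp_neg_nat.mul_left (Real.exp (x + 1)))
    fun k y hy => norm_smoothStepSlope_le hy k).continuousAt (Iio_mem_nhds (by linarith))

theorem staircaseSlope_nonneg (x : ℝ) : 0 ≤ staircaseSlope x :=
  tsum_nonneg fun k => smoothStepSlope_nonneg k x

theorem le_staircaseSlope_natCast (n : ℕ) : 1 / 4 ≤ staircaseSlope n := by
  rw [← smoothStepSlope_self n]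
  exact (summable_smoothStepSlope n).le_tsum n fun k _ => smoothStepSlope_nonneg k n

theorem contDiff_one_staircase : ContDiff ℝ 1 staircase :=
  contDiff_one_iff_deriv.2 ⟨fun x => (hasDerivAt_staircase x).differentiableAt, by
    rw [show deriv staircase = fun x => -staircaseSlope x from
      funext fun x => (hasDerivAt_staircase x).deriv]
    exact continuous_staircaseSlope.neg⟩

theorem antitone_staircase : Antitone staircase :=
  antitone_of_deriv_nonpos (fun x => (hasDerivAt_staircase x).differentiableAt) fun x => by
    rw [(hasDerivAt_staircase x).deriv]
    simpa using staircaseSlope_nonneg x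

theorem not_differentiableAt_shiftSum_staircase (m : ℕ) :
    ¬ DifferentiableAt ℝ (shiftSum staircase) m :=
  not_differentiableAt_shiftSum nonnegExpDecay_staircase antitone_staircase
    (F' := fun x => -staircaseSlope x) (by norm_num : (0 : ℝ) < 1 / 4)
    (fun j => hasDerivAt_staircase _)
    fun j => neg_le_neg (by exact_mod_cast le_staircaseSlope_natCast (m + j))

/-! ### The limit defining `Σ g` for functions tending to zero -/

theorem tendsto_fwdDiff_iterate {f : ℝ → ℝ} (hf : Tendsto f atTop (𝓝 0)) (n : ℕ) :
    Tendsto ((fwdDiff (1 : ℝ))^[n] f) atTop (𝓝 0) := by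
  induction n with
  | zero => exact hf
  | succ n ih =>
    rw [Function.iterate_succ_apply']
    have := (ih.comp (tendsto_atTop_add_const_right _ (1 : ℝ) tendsto_id)).sub ih
    rwa [sub_zero] at this

theorem NonnegExpDecay.tendsto_zero {F : ℝ → ℝ} (h : NonnegExpDecay F) :
    Tendsto F atTop (𝓝 0) := by
  obtain ⟨C, hC⟩ := h
  refine squeeze_zero (fun x => (hC x).1) (fun x => (hC x).2) ?_
  simpa using (Real.tendsto_exp_neg_atTop_nhds_zero).const_mul C

/-- All the correction terms in `approxSum q` vanish in the limit, whatever `q` is, since the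
differences of a function that tends to zero tend to zero as well. -/
theorem NonnegExpDecay.tendsto_approxSum {g : ℝ → ℝ} (h : NonnegExpDecay g) (q : ℕ) (x : ℝ) :
    Tendsto (fun n : ℕ => approxSum q n g x) atTop (𝓝 (shiftSum g 1 - shiftSum g x)) := by
  have hcorr : Tendsto (fun n : ℕ => ∑ j ∈ Finset.Icc 1 q,
      Ring.choose x j * (fwdDiff (1 : ℝ))^[j - 1] g n) atTop (𝓝 0) := by
    have : Tendsto (fun n : ℕ => ∑ j ∈ Finset.Icc 1 q,
        Ring.choose x j * (fwdDiff (1 : ℝ))^[j - 1] g n) atTop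
        (𝓝 (∑ j ∈ Finset.Icc 1 q, Ring.choose x j * 0)) :=
      tendsto_finsetSum _ fun j _ => (((tendsto_fwdDiff_iterate h.tendsto_zero (j - 1)).comp
        tendsto_natCast_atTop_atTop).const_mul _)
    simpa using this
  have hmain : Tendsto (fun n : ℕ => ∑ k ∈ Finset.range n, (g (1 + k) - g (x + k)) - g (x + n))
      atTop (𝓝 (shiftSum g 1 - shiftSum g x)) := by
    have h1 := ((h.summable 1).hasSum.sub (h.summable x).hasSum).tendsto_sum_nat
    have h2 := (h.summable x).tendsto_atTop_zero
    simpa [shiftSum] using h1.sub h2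
  -- shifting the index to `n + 1` turns the range `1, …, n` of summation into `n` full terms
  rw [← tendsto_add_atTop_iff_nat 1] at hcorr ⊢
  have hsum := hmain.add hcorr
  rw [add_zero] at hsum
  refine hsum.congr fun n => ?_
  rw [approxSum, Finset.sum_Ico_eq_sum_range, Finset.sum_sub_distrib, Finset.sum_sub_distrib,
    Nat.add_sub_cancel]
  have hshift : ∑ k ∈ Finset.range n, g (x + k) + g (x + n) =
      g x + ∑ k ∈ Finset.range n, g (x + ((1 + k : ℕ) : ℝ)) := by
    rw [← Finset.sum_range_succ (fun k : ℕ => g (x + k)), Finset.sum_range_succ']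
    simp [add_comm]
  push_cast at hshift ⊢
  linarith

theorem NonnegExpDecay.sigmaMap_eq {g : ℝ → ℝ} (h : NonnegExpDecay g) :
    sigmaMap g = fun x => shiftSum g 1 - shiftSum g x :=
  funext fun x => (h.tendsto_approxSum _ x).limUnder_eq

theorem differentiableAt_iteratedDeriv_const_sub_iff (n : ℕ) (c : ℝ) (f : ℝ → ℝ) (x : ℝ) :
    DifferentiableAt ℝ (iteratedDeriv n fun y => c - f y) x ↔
      DifferentiableAt ℝ (iteratedDeriv n f) x := by
  cases n with
  | zero => simp [iteratedDeriv_zero]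
  | succ n =>
    have : (deriv fun y => c - f y) = -deriv f := funext fun y => by simp
    rw [iteratedDeriv_succ', iteratedDeriv_succ', this,
      show iteratedDeriv n (-deriv f) = -iteratedDeriv n (deriv f) from
        funext fun y => iteratedDeriv_neg n _ y]
    exact differentiableAt_neg_iff

/-- A derivative of order `p + 1` of constant sign makes a function `p`-convex or `p`-concave. -/
theorem mem_classK_of_iteratedDeriv_eq {p : ℕ} {g h : ℝ → ℝ} (hg : ContDiff ℝ (p + 1 : ℕ) g)
    (hd : iteratedDeriv (p + 1) g = fun x => (-1) ^ (p + 1) * h x) (hh : ∀ x, 0 ≤ h x) :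
    g ∈ ClassK p := by
  rcases Nat.even_or_odd (p + 1) with he | ho
  · refine Or.inl ⟨1, one_pos, fun x hx _ => ?_⟩
    obtain ⟨ξ, hξ⟩ := exists_divDiff_eq_iteratedDeriv hg hx
    rw [hξ, hd]
    simp only [he.neg_one_pow, one_mul]
    exact div_nonneg (hh ξ) (by positivity)
  · refine Or.inr ⟨1, one_pos, fun x hx _ => ?_⟩
    obtain ⟨ξ, hξ⟩ := exists_divDiff_eq_iteratedDeriv hg hx
    rw [hξ, hd]
    simp only [ho.neg_one_pow, neg_mul, one_mul]
    exact div_nonpos_of_nonpos_of_nonneg (neg_nonpos.2 (hh ξ)) (by positivity)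

end PrincipalSum

theorem proposition7p3 (p : ℕ) :
    ∃ g : ℝ → ℝ,
      g ∈ PrincipalSum.ClassC (p + 1) ∩ PrincipalSum.ClassD p ∩ PrincipalSum.ClassK p ∧
      -- the limit that defines `Σ g` exists on `(0, ∞)`, and every admissible order gives `Σ g`
      (∀ q : ℕ, g ∈ PrincipalSum.ClassD q ∩ PrincipalSum.ClassK q → ∀ x : ℝ, 0 < x →
        Tendsto (fun n : ℕ => PrincipalSum.approxSum q n g x) atTop
          (𝓝 (PrincipalSum.sigmaMap g x))) ∧
      PrincipalSum.sigmaMap g ∉ PrincipalSum.ClassC (p + 1) ∧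
      -- more precisely, `Σ g` is of class `𝒞ᵖ` and its `p`-th derivative is not differentiable
      -- at any positive integer
      PrincipalSum.sigmaMap g ∈ PrincipalSum.ClassC p ∧
      ∀ m : ℕ, 1 ≤ m →
        ¬ DifferentiableAt ℝ (iteratedDeriv p (PrincipalSum.sigmaMap g)) (m : ℝ) := by
  set u : ℕ → ℝ → ℝ := fun i => PrincipalSum.tailIntegral^[i] PrincipalSum.staircase
  have hspec : ∀ i, PrincipalSum.NonnegExpDecay (u i) ∧ Continuous (u i) :=
    PrincipalSum.nonnegExpDecay_and_continuous_iterate_tailIntegral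
      PrincipalSum.nonnegExpDecay_staircase
      PrincipalSum.contDiff_one_staircase.continuous
  have hchain : ∀ i x, HasDerivAt (u (i + 1)) (-u i x) x :=
    PrincipalSum.hasDerivAt_iterate_tailIntegral
      PrincipalSum.nonnegExpDecay_staircase
      PrincipalSum.contDiff_one_staircase.continuous
  have hdecay := (hspec p).1
  obtain ⟨hsmooth, hiter⟩ := PrincipalSum.contDiff_and_iteratedDeriv_of_chain hchain (k := 1)
    (by exact_mod_cast PrincipalSum.contDiff_one_staircase) p
  -- the sums of the translates form a chain as well, starting from a merely continuous function
  obtain ⟨hSsmooth, hSiter⟩ := PrincipalSum.contDiff_and_iteratedDeriv_of_chain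
    (u := fun i => PrincipalSum.shiftSum (u i)) (k := 0)
    (fun i => PrincipalSum.hasDerivAt_shiftSum (hspec i).1 (hspec (i + 1)).1 (hchain i))
    (by
      rw [Nat.cast_zero, contDiff_zero]
      exact (hspec 0).1.continuous_shiftSum (hspec 0).2) p
  have hiter_succ : iteratedDeriv (p + 1) (u p) =
      fun x => (-1) ^ (p + 1) * PrincipalSum.staircaseSlope x := by
    ext x
    rw [iteratedDeriv_succ, hiter]
    exact (((PrincipalSum.hasDerivAt_staircase x).const_mul _).deriv).trans (by ring)
  have hnot : ∀ m : ℕ,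
      ¬ DifferentiableAt ℝ (iteratedDeriv p (PrincipalSum.sigmaMap (u p))) (m : ℝ) := by
    intro m hm
    rw [hdecay.sigmaMap_eq, PrincipalSum.differentiableAt_iteratedDeriv_const_sub_iff,
      hSiter] at hm
    refine PrincipalSum.not_differentiableAt_shiftSum_staircase m ?_
    have := hm.const_mul ((-1 : ℝ) ^ p)
    simp only [← mul_assoc, ← mul_pow, neg_mul_neg, one_mul, one_pow] at this
    exact this
  refine ⟨u p, ⟨⟨?_, PrincipalSum.tendsto_fwdDiff_iterate hdecay.tendsto_zero p⟩,
    PrincipalSum.mem_classK_of_iteratedDeriv_eq hsmooth hiter_succ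
      PrincipalSum.staircaseSlope_nonneg⟩, ?_, ?_, ?_, fun m _ => hnot m⟩
  · exact hsmooth.contDiffOn
  · intro q _ x _
    rw [hdecay.sigmaMap_eq]
    exact hdecay.tendsto_approxSum q x
  · intro hmem
    have hmem' : ContDiffOn ℝ (p + 1 : ℕ) (PrincipalSum.sigmaMap (u p)) (Ioi 0) := hmem
    have hnhds : Ioi (0 : ℝ) ∈ 𝓝 ((1 : ℕ) : ℝ) := Ioi_mem_nhds (by norm_num)
    refine hnot 1 ?_
    have hdiff := hmem'.differentiableOn_iteratedDerivWithin (m := p)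
      (by exact_mod_cast Nat.lt_succ_self p) isOpen_Ioi.uniqueDiffOn
    refine (hdiff.differentiableAt hnhds).congr_of_eventuallyEq ?_
    filter_upwards [hnhds] with x hx
    exact (iteratedDerivWithin_of_isOpen isOpen_Ioi hx).symm
  · have : ContDiff ℝ p (PrincipalSum.sigmaMap (u p)) := by
      rw [hdecay.sigmaMap_eq]
      exact contDiff_const.sub hSsmooth
    exact this.contDiffOn
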